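/- Let $k\ge 2$ and let $R_k$ be the counter-clockwise rotation of $\mathbb{R}^2$ about the origin through the angle $2\pi/k$. Let $\tilde G$ be a finite multigraph with at least one vertex (loops and parallel edges allowed), and let $\varphi$ be an action of $\mathbb{Z}/k\mathbb{Z}$ on $\tilde G$ by automorphisms that is free on the vertices and free on the edges. A symmetric direction assignment is a family $\mathbf{d}=(\mathbf{d}_e)_{e\in E(\tilde G)}$ of vectors in $\mathbb{R}^2$ with $\mathbf{d}_{\varphi(\gamma)\cdot e}=R_k^{\gamma}\mathbf{d}_e$ for all $\gamma\in\mathbb{Z}/k\mathbb{Z}$ and all edges $e$; the triple $(\tilde G,\varphi,\mathbf{d})$ is a cone direction network. If $\varphi$ has $m$ edge orbits, then the symmetric direction assignments form a real vector space that is identified with $\mathbb{R}^{2m}$ by choosing one edge in each orbit. A realization of $(\tilde G,\varphi,\mathbf{d})$ is a family $\mathbf{p}=(\mathbf{p}_i)_{i\in V(\tilde G)}$ of points of $\mathbb{R}^2$ with $$\langle \mathbf{p}_j-\mathbf{p}_i,\mathbf{d}_{e}^{\perp}\rangle=0\ \text{ for every edge } e \text{ with endpoints } i,j,\qquad \mathbf{p}_{\varphi(\gamma)\cdot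 i}=R_k^{\gamma}\,\mathbf{p}_i\ \text{ for all }\gamma\in\mathbb{Z}/k\mathbb{Z},\ i\in V(\tilde G),$$ where $\mathbf{v}^\perp$ is $\mathbf{v}$ rotated counter-clockwise by $\pi/2$. It is faithful if no edge of $\tilde G$ has coincident endpoints, and a faithful realization is unique up to scaling if every faithful realization is a real multiple of it. A colored graph $(G,\boldsymbol\gamma)$ is a finite directed multigraph $G$ with an element $\gamma_e\in\mathbb{Z}/k\mathbb{Z}$ on each edge $e$. Its lift has the vertices $\tilde i_{g}$ ($i\in V(G)$, $g\in\mathbb{Z}/k\mathbb{Z}$) and, for every edge $e$ from $i$ to $j$ and every $g\in\mathbb{Z}/k\mathbb{Z}$, an edge $\tilde e_g$ joining $\tilde i_g$ to $\tilde j_{g+\gamma_{e}}$; the group $\mathbb{Z}/k\mathbb{Z}$ acts on the lift by translating the indices $g$. The colored graph is associated with $(\tilde G,\varphi)$ if its lift is equivariantly isomorphic to $(\tilde G,\varphi)$. Let $\rho$ be the map that sends an integral cycle $z$ of $G$ to $\sum_e z_e\gamma_e\in\mathbb{Z}/k\mathbb{Z}$. The colored graph $(G,\boldsymbol\gamma)$,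 with $n$ vertices and $m$ edges, is cone-Laman if $m=2n-1$ and, for every set of $m'$ edges of $G$, $$m'\le 2n'-c'-3c'_0,$$ where the subgraph consisting of these edges and their endpoints has $n'$ vertices, $c'$ connected components on whose cycles $\rho$ is not identically zero, and $c'_0$ connected components on whose cycles $\rho$ is identically zero. Theorem. Let $(G,\boldsymbol\gamma)$ be a colored graph associated with $(\tilde G,\varphi)$. Then for generic $\mathbf{d}$, that is, for all $\mathbf{d}$ outside some proper algebraic subset of the space $\mathbb{R}^{2m}$ of symmetric direction assignments, the cone direction network $(\tilde G,\varphi,\mathbf{d})$ has a faithful realization that is unique up to scaling if and only if $(G,\boldsymbol\gamma)$ is cone-Laman. -/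

import Mathlib

open scoped InnerProductSpace

/-! ### Symmetric graphs and colored graphs -/

/-- A multigraph with vertex set `V` and edge set `E` (loops and parallel edges are allowed; an edge
has an unordered pair of endpoints), together with an action of `ℤ/kℤ` by graph automorphisms
that is free on the vertices and free on the edges. -/
structure SymmetricGraph (k : ℕ) (V E : Type*) where
  /-- the two endpoints of an edge -/
  ends : E → Sym2 V
  /-- the action on the vertices -/
  actV : ZMod k → V → V
  /-- the action on the edges -/
  actE : ZMod k → E → E
  actV_zero : ∀ v, actV 0 v = v
  actV_add : ∀ g h v, actV (g + h) v = actV g (actV h v)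
  actE_zero : ∀ e, actE 0 e = e
  actE_add : ∀ g h e, actE (g + h) e = actE g (actE h e)
  ends_actE : ∀ g e, ends (actE g e) = (ends e).map (actV g)
  actV_free : ∀ g v, actV g v = v → g = 0
  actE_free : ∀ g e, actE g e = e → g = 0

/-- An isomorphism of symmetric graphs: an equivariant isomorphism of multigraphs. -/
structure SymmetricGraph.Iso {k : ℕ} {V E V' E' : Type*}
    (G : SymmetricGraph k V E) (G' : SymmetricGraph k V' E') where
  onV : V ≃ V'
  onE : E ≃ E'
  ends_onE : ∀ e, G'.ends (onE e) = (G.ends e).map onV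
  onV_actV : ∀ g v, onV (G.actV g v) = G'.actV g (onV v)
  onE_actE : ∀ g e, onE (G.actE g e) = G'.actE g (onE e)

/-- A colored graph (gain graph): a directed multigraph with an element of `ℤ/kℤ` on each edge. -/
structure ColoredGraph (k : ℕ) (V E : Type*) where
  tail : E → V
  head : E → V
  color : E → ZMod k

/-- The lift of a colored graph: the fiber over a vertex `i` consists of the vertices `(i, g)`, and
the fiber over an edge `e` from `i` to `j` of color `γ` consists of the edges `(e, g)` joining
`(i, g)` to `(j, g + γ)`, where `g` ranges over `ℤ/kℤ`. -/
def ColoredGraph.lift {k : ℕ} {V E : Type*} (G : ColoredGraph k V E) :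
    SymmetricGraph k (V × ZMod k) (E × ZMod k) where
  ends e := s((G.tail e.1, e.2), (G.head e.1, e.2 + G.color e.1))
  actV g v := (v.1, g + v.2)
  actE g e := (e.1, g + e.2)
  actV_zero v := by simp
  actV_add g h v := by simp [add_assoc]
  actE_zero e := by simp
  actE_add g h e := by simp [add_assoc]
  ends_actE g e := by simp [add_assoc]
  actV_free g v h := by simpa using congrArg Prod.snd h
  actE_free g e h := by simpa using congrArg Prod.snd h

/-- The colored graph `G` is associated with (is a colored quotient of) the symmetric graph `S`:
the lift of `G` is isomorphic to `S`. -/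
def ColoredGraph.IsAssociatedWith {k : ℕ} {V E V' E' : Type*} (G : ColoredGraph k V E)
    (S : SymmetricGraph k V' E') : Prop :=
  Nonempty (SymmetricGraph.Iso G.lift S)

/-- A free action of `ℤ/kℤ` has a system of orbit representatives. -/
theorem exists_orbit_representatives {k : ℕ} {X : Type*} (a : ZMod k → X → X)
    (h0 : ∀ x, a 0 x = x) (hadd : ∀ g h x, a (g + h) x = a g (a h x))
    (hfree : ∀ g x, a g x = x → g = 0) :
    ∃ R : Set X, Function.Bijective fun z : R × ZMod k => a z.2 z.1 := by
  let s : Setoid X :=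
    { r := fun x y => ∃ g, a g x = y
      iseqv :=
        { refl := fun x => ⟨0, h0 x⟩
          symm := by
            rintro x y ⟨g, rfl⟩
            exact ⟨-g, by rw [← hadd, neg_add_cancel, h0]⟩
          trans := by
            rintro x y z ⟨g, rfl⟩ ⟨h, rfl⟩
            exact ⟨h + g, hadd _ _ _⟩ } }
  refine ⟨Set.range (Quotient.out : Quotient s → X), ?_, ?_⟩
  · rintro ⟨⟨_, q, rfl⟩, g⟩ ⟨⟨_, q', rfl⟩, g'⟩ h
    simp only at h
    have hq : q = q' := by
      rw [← Quotient.out_eq q, ← Quotient.out_eq q']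
      refine Quotient.sound ⟨-g' + g, ?_⟩
      rw [hadd, h, ← hadd, neg_add_cancel, h0]
    subst hq
    have : -g' + g = 0 := hfree _ q.out (by rw [hadd, h, ← hadd, neg_add_cancel, h0])
    have : g = g' := by rw [neg_add_eq_zero] at this; exact this.symm
    subst this
    rfl
  · intro x
    obtain ⟨g, hg⟩ : ∃ g, a g (Quotient.mk s x).out = x := Quotient.mk_out (s := s) x
    exact ⟨(⟨_, _, rfl⟩, g), hg⟩

/-- Every symmetric graph has an associated colored graph. -/
theorem SymmetricGraph.exists_isAssociatedWith {k : ℕ} {V' : Type*} {E' : Type*}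
    (S : SymmetricGraph k V' E') :
    ∃ (V : Set V') (E : Set E') (G : ColoredGraph k V E), G.IsAssociatedWith S := by
  obtain ⟨V, hV⟩ := exists_orbit_representatives S.actV S.actV_zero S.actV_add S.actV_free
  obtain ⟨E, hE⟩ := exists_orbit_representatives S.actE S.actE_zero S.actE_add S.actE_free
  have key : ∀ e : E, ∃ (i j : V) (g h : ZMod k), S.ends e = s(S.actV h i, S.actV (h + g) j) := by
    intro e
    obtain ⟨x, y, hxy⟩ : ∃ x y, S.ends e = s(x, y) :=
      Sym2.ind (f := fun z => ∃ x y, z = s(x, y)) (fun x y => ⟨x, y, rfl⟩) (S.ends e)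
    obtain ⟨⟨i, h⟩, rfl⟩ := hV.2 x
    obtain ⟨⟨j, h'⟩, rfl⟩ := hV.2 y
    exact ⟨i, j, h' - h, h, by simpa using hxy⟩
  choose t u c b hends using key
  let fE : E × ZMod k ≃ E × ZMod k :=
    { toFun := fun z => (z.1, z.2 - b z.1)
      invFun := fun z => (z.1, z.2 + b z.1)
      left_inv := fun z => by simp
      right_inv := fun z => by simp }
  refine ⟨V, E, ⟨t, u, c⟩, ⟨⟨Equiv.ofBijective _ hV, fE.trans (Equiv.ofBijective _ hE), ?_, ?_, ?_⟩⟩⟩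
  · rintro ⟨e, g⟩
    simp [fE, ColoredGraph.lift, S.ends_actE, hends, ← S.actV_add]
    simp [← add_assoc]
  · rintro g ⟨v, h⟩
    simp [ColoredGraph.lift, S.actV_add]
  · rintro g ⟨e, h⟩
    simp [fE, ColoredGraph.lift, ← S.actE_add, add_sub_assoc]

/-! ### The map `ρ` and cone-Laman graphs -/

namespace ColoredGraph

variable {k : ℕ} {V E : Type*}

open Classical in
/-- The boundary map from integral 1-chains to integral 0-chains. -/
noncomputable def boundary [Fintype E] (G : ColoredGraph k V E) : (E → ℤ) →+ (V → ℤ) where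
  toFun z v := ∑ e, z e * ((if G.head e = v then 1 else 0) - (if G.tail e = v then 1 else 0))
  map_zero' := by ext v; simp
  map_add' y z := by ext v; simp [add_mul, Finset.sum_add_distrib]

/-- The sum of the colors along an integral 1-chain; on cycles this is the map `ρ`. -/
def rho [Fintype E] (G : ColoredGraph k V E) : (E → ℤ) →+ ZMod k where
  toFun z := ∑ e, (z e : ZMod k) * G.color e
  map_zero' := by simp
  map_add' y z := by simp [add_mul, Finset.sum_add_distrib]

/-- The first homology group of the subgraph with edge set `A`: the integral 1-cycles that are
supported on `A`. -/
def H1 [Fintype E] (G : ColoredGraph k V E) (A : Set E) : AddSubgroup (E → ℤ) where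
  carrier := {z | G.boundary z = 0 ∧ ∀ e, e ∉ A → z e = 0}
  zero_mem' := by simp
  add_mem' := by
    rintro y z ⟨hy, hy'⟩ ⟨hz, hz'⟩
    exact ⟨by rw [map_add, hy, hz, add_zero], fun e he => by simp [hy' e he, hz' e he]⟩
  neg_mem' := by
    rintro z ⟨hz, hz'⟩
    exact ⟨by rw [map_neg, hz, neg_zero], fun e he => by simp [hz' e he]⟩

/-- The `ρ`-image of the subgraph with edge set `A`. -/
def rhoImage [Fintype E] (G : ColoredGraph k V E) (A : Set E) : AddSubgroup (ZMod k) :=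
  (G.H1 A).map G.rho

/-- The vertices spanned by a set of edges. -/
def verts (G : ColoredGraph k V E) (F : Finset E) : Set V :=
  {v | ∃ e ∈ F, G.tail e = v ∨ G.head e = v}

/-- The simple graph underlying the subgraph with edge set `F`, on the vertices that `F` spans. -/
def underlying (G : ColoredGraph k V E) (F : Finset E) : SimpleGraph (G.verts F) :=
  SimpleGraph.fromRel fun u v => ∃ e ∈ F, G.tail e = u.1 ∧ G.head e = v.1

/-- The connected components of the subgraph with edge set `F`. -/
abbrev Component (G : ColoredGraph k V E) (F : Finset E) : Type _ :=
  (G.underlying F).ConnectedComponent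

/-- The edges of a connected component of the subgraph with edge set `F`. -/
def compEdges (G : ColoredGraph k V E) (F : Finset E) (c : G.Component F) : Set E :=
  {e | e ∈ F ∧ ∃ v ∈ c.supp, G.tail e = v.1}

/-- The number of connected components with non-trivial `ρ`-image. -/
noncomputable def numNontrivial [Fintype E] (G : ColoredGraph k V E) (F : Finset E) : ℕ :=
  Nat.card {c : G.Component F // G.rhoImage (G.compEdges F c) ≠ ⊥}

/-- The number of connected components with trivial `ρ`-image. -/
noncomputable def numTrivial [Fintype E] (G : ColoredGraph k V E) (F : Finset E) : ℕ :=
  Nat.card {c : G.Component F // G.rhoImage (G.compEdges F c) = ⊥}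

/-- Cone-Laman graphs: `m = 2 n - 1`, and `m' ≤ 2 n' - c' - 3 c'₀` for the subgraph formed by any set
of edges together with the vertices spanned by them. -/
def IsConeLaman [Fintype V] [Fintype E] (G : ColoredGraph k V E) : Prop :=
  (Fintype.card E : ℤ) = 2 * (Fintype.card V : ℤ) - 1 ∧
    ∀ F : Finset E, (F.card : ℤ) ≤
      2 * (Nat.card (G.verts F) : ℤ) - (G.numNontrivial F : ℤ) - 3 * (G.numTrivial F : ℤ)

end ColoredGraph

/-! ### Cone direction networks

The Euclidean plane is `ℂ`, with its real inner product; `Complex.I * d` is `d` turned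
counter-clockwise by `π / 2`. -/

/-- The rotation `R_k ^ g` about the origin, where `R_k` is the counter-clockwise rotation
through the angle `2 π / k`. -/
noncomputable def coneRotation (k : ℕ) [NeZero k] (g : ZMod k) : ℂ ≃ₗᵢ[ℝ] ℂ :=
  rotation (ZMod.toCircle g)

namespace SymmetricGraph

variable {k : ℕ} [NeZero k] {V E : Type*}

/-- The symmetric assignments of a direction to each edge. A cone direction network is a symmetric
graph with an element of this set. -/
def Directions (S : SymmetricGraph k V E) : Set (E → ℂ) :=
  {d | ∀ g e, d (S.actE g e) = coneRotation k g (d e)}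

/-- `p` is a realization of the cone direction network `(S, d)`. -/
def IsRealization (S : SymmetricGraph k V E) (d : E → ℂ) (p : V → ℂ) : Prop :=
  (∀ e i j, S.ends e = s(i, j) → ⟪p j - p i, Complex.I * d e⟫_ℝ = 0) ∧
    ∀ g i, p (S.actV g i) = coneRotation k g (p i)

/-- No edge has coincident endpoints. -/
def IsFaithful (S : SymmetricGraph k V E) (p : V → ℂ) : Prop :=
  ∀ e i j, S.ends e = s(i, j) → p i ≠ p j

/-- The direction network `(S, d)` has a faithful realization that is unique up to scaling. -/
def HasUniqueFaithfulRealization (S : SymmetricGraph k V E) (d : E → ℂ) : Prop :=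
  ∃ p, S.IsRealization d p ∧ S.IsFaithful p ∧
    ∀ q, S.IsRealization d q → S.IsFaithful q → ∃ c : ℝ, q = c • p

/-- The real coordinates of an assignment of directions. -/
def coords (d : E → ℂ) : E × Fin 2 → ℝ :=
  fun x => if x.2 = 0 then (d x.1).re else (d x.1).im

/-- The algebraic subset of the space of symmetric direction assignments cut out by a set of
polynomials. The symmetric assignments form a real vector space with the directions
of one edge per orbit as linear coordinates, and the polynomial functions in these coordinates are the
restrictions of the polynomials in the coordinates of all the directions. -/
def algebraicSubset (S : SymmetricGraph k V E) (I : Set (MvPolynomial (E × Fin 2) ℝ)) :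
    Set (E → ℂ) :=
  {d | d ∈ S.Directions ∧ ∀ f ∈ I, MvPolynomial.eval (coords d) f = 0}

/-- A property of symmetric direction assignments holds generically: it holds on the complement of
a proper algebraic subset of the space of all symmetric direction assignments. -/
def Generically (S : SymmetricGraph k V E) (P : (E → ℂ) → Prop) : Prop :=
  ∃ I : Set (MvPolynomial (E × Fin 2) ℝ), S.algebraicSubset I ≠ S.Directions ∧
    ∀ d ∈ S.Directions, d ∉ S.algebraicSubset I → P d

end SymmetricGraph

/-! A symmetric placement of the lift is the same as a point `q : V → ℂ`, and all lifts of an edge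
`e` impose one linear condition on `q`, the form `edgeForm e (d e)` in a dual space of dimension
`2n`. As `d e` varies, this form runs through the span of the two forms `coordForms e`, whose common
zeros are the placements that collapse `e`. Rado's theorem therefore governs generic rank: the forms
of a set of edges are generically independent as soon as every subset `F` satisfies `|F| ≤ r(F)`,
where `r = collapseRank`.

The rank `r` is combinatorial. In a placement that collapses `F`, the point at one vertex determines
the points on its whole component, by rotation; a cycle with nonzero `ρ` forces them to be zero,
while on a component with trivial `ρ` one complex parameter is free. Hence `r(F) = 2n' - 2c'₀`, and
the cone-Laman count reads `m' ≤ r(F) - (c' + c'₀)`. Summing over components, this holds for all `F`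
if and only if `|F| < r(F)` for all nonempty `F`.

Under this strict inequality the edge forms are generically independent, so realizations have
dimension `2n - m`, and `m = 2n - 1` gives a line. The unit of slack allows one more form of any
chosen edge to be added independently; then no nonzero realization collapses that edge
(`generically_displacement_ne_zero`). If `m ≠ 2n - 1`, the dimension is at least two and uniqueness
fails. If `|F| ≥ r(F)` for some nonempty `F`, a minimal such `F` has generic forms that span all its
collapsing forms, so its edges collapse in every realization
(`generically_exists_displacement_eq_zero`). -/

/-! ### Independent transversals -/

section Transversal

open Module Submodule

variable {K W ι : Type*} [Field K] [AddCommGroup W] [Module K W]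

/-- The span of the vectors in the members of a subfamily. -/
def familySpan (K : Type*) {W ι : Type*} [Field K] [AddCommGroup W] [Module K W]
    (A : ι → Finset W) (F : Finset ι) : Submodule K W :=
  span K (⋃ i ∈ F, (A i : Set W))

theorem familySpan_mono_right {A : ι → Finset W} {F F' : Finset ι} (h : F ⊆ F') :
    familySpan K A F ≤ familySpan K A F' :=
  span_mono (Set.biUnion_subset_biUnion_left h)

theorem subset_familySpan {A : ι → Finset W} {F : Finset ι} {i : ι} (hi : i ∈ F) {x : W}
    (hx : x ∈ A i) : x ∈ familySpan K A F :=
  subset_span (Set.mem_biUnion (Finset.mem_coe.2 hi) hx)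

variable [FiniteDimensional K W]

/-- The deletion step of Rado's theorem, by submodularity of dimension. If deleting `x` and deleting
`y` both broke the condition, with witnesses `F ∪ {i}` and `F' ∪ {i}`, then the sum of the two small
spans would contain all of `A i`, and the dimensions of sum and intersection would add up to at
least `|F ∪ F'| + 1 + |F ∩ F'|`, one too many. -/
theorem exists_update_erase_of_two_mem [DecidableEq ι] [DecidableEq W] (A : ι → Finset W)
    (hA : ∀ F, F.card ≤ finrank K (familySpan K A F)) {i : ι} {x y : W} (hxy : x ≠ y) :
    ∃ z ∈ ({x, y} : Finset W), ∀ F,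
      F.card ≤ finrank K (familySpan K (Function.update A i ((A i).erase z)) F) := by
  by_contra! hcon
  have key : ∀ z ∈ ({x, y} : Finset W), ∃ F : Finset ι, i ∉ F ∧
      finrank K (span K (((A i).erase z : Finset W) : Set W) ⊔ familySpan K A F :
        Submodule K W) ≤ F.card := by
    intro z hz
    obtain ⟨F, hF⟩ := hcon z hz
    have hagree : ∀ F' : Finset ι, i ∉ F' →
        familySpan K (Function.update A i ((A i).erase z)) F' = familySpan K A F' := by
      intro F' hF'
      unfold familySpan
      congr 1
      refine Set.iUnion₂_congr fun j hj => ?_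
      rw [Function.update_of_ne (by rintro rfl; exact hF' hj)]
    have hi : i ∈ F := by
      by_contra hi
      rw [hagree F hi] at hF
      exact absurd (hA F) (not_le.2 hF)
    refine ⟨F.erase i, Finset.notMem_erase i F, ?_⟩
    rw [Finset.card_erase_of_mem hi, ← hagree _ (Finset.notMem_erase i F)]
    refine Nat.le_sub_one_of_lt (lt_of_le_of_lt (finrank_mono (sup_le ?_ ?_)) hF)
    · refine span_mono fun w hw => Set.mem_biUnion (Finset.mem_coe.2 hi) ?_
      simpa using hw
    · exact familySpan_mono_right (Finset.erase_subset i F)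
  obtain ⟨F, hiF, hF⟩ := key x (by simp)
  obtain ⟨F', hiF', hF'⟩ := key y (by simp)
  have hsum := finrank_sup_add_finrank_inf_eq
    (span K (((A i).erase x : Finset W) : Set W) ⊔ familySpan K A F)
    (span K (((A i).erase y : Finset W) : Set W) ⊔ familySpan K A F')
  have h1 : (insert i (F ∪ F')).card ≤ finrank K
      ((span K (((A i).erase x : Finset W) : Set W) ⊔ familySpan K A F) ⊔
      (span K (((A i).erase y : Finset W) : Set W) ⊔ familySpan K A F') : Submodule K W) := by
    refine (hA _).trans (finrank_mono (span_le.2 ?_))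
    intro w hw
    simp only [Set.mem_iUnion, Finset.mem_insert, Finset.mem_union, Finset.mem_coe] at hw
    obtain ⟨j, hj, hw⟩ := hw
    rcases hj with rfl | hj | hj
    -- Since `x ≠ y`, the vector `x` survives the deletion of `y`, and every other vector of `A i`
    -- survives the deletion of `x`.
    · by_cases hwx : w = x
      · exact mem_sup_right (mem_sup_left (subset_span (by simp [hwx ▸ hw, hwx, hxy])))
      · exact mem_sup_left (mem_sup_left (subset_span (by simp [hwx, hw])))
    · exact mem_sup_left (mem_sup_right (subset_familySpan hj hw))
    · exact mem_sup_right (mem_sup_right (subset_familySpan hj hw))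
  have h2 : (F ∩ F').card ≤ finrank K
      ((span K (((A i).erase x : Finset W) : Set W) ⊔ familySpan K A F) ⊓
      (span K (((A i).erase y : Finset W) : Set W) ⊔ familySpan K A F') : Submodule K W) :=
    (hA _).trans (finrank_mono (le_inf
      ((familySpan_mono_right Finset.inter_subset_left).trans le_sup_right)
      ((familySpan_mono_right Finset.inter_subset_right).trans le_sup_right)))
  rw [Finset.card_insert_of_notMem (by simp [hiF, hiF'])] at h1
  have := Finset.card_union_add_card_inter F F'
  omega

/-- Rado's theorem: a finite family of finite sets of vectors in which every `n` members span a
space of dimension at least `n` has a linearly independent transversal. -/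
theorem exists_linearIndependent_transversal [Fintype ι] (A : ι → Finset W)
    (hA : ∀ F, F.card ≤ finrank K (familySpan K A F)) :
    ∃ x : ι → W, (∀ i, x i ∈ A i) ∧ LinearIndependent K x := by
  classical
  induction hN : ∑ i, (A i).card using Nat.strong_induction_on generalizing A with
  | _ N ih =>
  subst hN
  by_cases h : ∃ i, 1 < (A i).card
  · obtain ⟨i, hi⟩ := h
    obtain ⟨x, hx, y, hy, hxy⟩ := Finset.one_lt_card.1 hi
    obtain ⟨z, hz, hH⟩ := exists_update_erase_of_two_mem A hA (i := i) hxy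
    have hzA : z ∈ A i := by
      rcases Finset.mem_insert.1 hz with rfl | hz
      · exact hx
      · exact Finset.mem_singleton.1 hz ▸ hy
    have hle : ∀ j, Function.update A i ((A i).erase z) j ⊆ A j := by
      intro j
      by_cases hj : j = i
      · subst hj; simpa using Finset.erase_subset _ _
      · simp [hj]
    obtain ⟨w, hw, hind⟩ := ih _ (Finset.sum_lt_sum (fun j _ => Finset.card_le_card (hle j))
      ⟨i, Finset.mem_univ i, by simpa using Finset.card_erase_lt_of_mem hzA⟩) _ hH rfl
    exact ⟨w, fun j => hle j (hw j), hind⟩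
  · push Not at h
    have hne : ∀ i, (A i).Nonempty := by
      intro i
      by_contra hi
      have h0 : familySpan K A {i} = ⊥ := by
        rw [Finset.not_nonempty_iff_eq_empty] at hi
        simp [familySpan, hi]
      have := hA {i}
      rw [h0, finrank_bot] at this
      simp at this
    choose x hx using hne
    refine ⟨x, hx, linearIndependent_iff_card_le_finrank_span.2 ((hA Finset.univ).trans ?_)⟩
    refine finrank_mono (span_mono ?_)
    simp only [Set.iUnion_subset_iff]
    intro i _ w hw
    exact ⟨i, Finset.card_le_one.1 (h i) _ (hx i) _ hw⟩

end Transversal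

/-! ### Generic properties of points -/

section Generic

variable {σ : Type*} {P Q : (σ → ℝ) → Prop}

/-- A property of real vectors that holds off the zero set of a nonzero polynomial. -/
def HoldsGenerically (P : (σ → ℝ) → Prop) : Prop :=
  ∃ f : MvPolynomial σ ℝ, f ≠ 0 ∧ ∀ x, MvPolynomial.eval x f ≠ 0 → P x

theorem HoldsGenerically.mono (hP : HoldsGenerically P) (h : ∀ x, P x → Q x) :
    HoldsGenerically Q :=
  let ⟨f, hf, hfP⟩ := hP
  ⟨f, hf, fun x hx => h x (hfP x hx)⟩

theorem HoldsGenerically.of_forall (h : ∀ x, P x) : HoldsGenerically P :=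
  ⟨1, one_ne_zero, fun x _ => h x⟩

theorem HoldsGenerically.and (hP : HoldsGenerically P) (hQ : HoldsGenerically Q) :
    HoldsGenerically fun x => P x ∧ Q x := by
  obtain ⟨f, hf, hfP⟩ := hP
  obtain ⟨g, hg, hgQ⟩ := hQ
  refine ⟨f * g, mul_ne_zero hf hg, fun x hx => ?_⟩
  rw [map_mul] at hx
  exact ⟨hfP x (left_ne_zero_of_mul hx), hgQ x (right_ne_zero_of_mul hx)⟩

theorem HoldsGenerically.forall {ι : Type*} [Finite ι] {P : ι → (σ → ℝ) → Prop}
    (hP : ∀ i, HoldsGenerically (P i)) : HoldsGenerically fun x => ∀ i, P i x := by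
  have := Fintype.ofFinite ι
  choose f hf hfP using hP
  refine ⟨∏ i, f i, Finset.prod_ne_zero_iff.2 fun i _ => hf i, fun x hx i => hfP i x ?_⟩
  rw [map_prod] at hx
  exact Finset.prod_ne_zero_iff.1 hx i (Finset.mem_univ i)

/-- A polynomial family of vectors that is linearly independent at one point is generically
linearly independent. -/
theorem HoldsGenerically.linearIndependent {W ι : Type*} [AddCommGroup W] [Module ℝ W] [Finite ι]
    (x : (σ → ℝ) → ι → W)
    (hx : ∀ (i : ι) (φ : W →ₗ[ℝ] ℝ), ∃ f : MvPolynomial σ ℝ,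
      ∀ s, φ (x s i) = MvPolynomial.eval s f)
    {s₀ : σ → ℝ} (h₀ : LinearIndependent ℝ (x s₀)) :
    HoldsGenerically fun s => LinearIndependent ℝ (x s) := by
  classical
  have := Fintype.ofFinite ι
  -- The coordinates `g` send the family at `s₀` to the standard basis, so the determinant of the
  -- family in these coordinates is a polynomial with value `1` at `s₀`; wherever it is nonzero the
  -- family is independent.
  obtain ⟨g, hg⟩ := (Fintype.linearCombination ℝ (x s₀)).exists_leftInverse_of_injective
    (LinearMap.ker_eq_bot.2 (linearIndependent_iff_injective_fintypeLinearCombination.1 h₀))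
  choose f hf using fun i j => hx i (LinearMap.proj j ∘ₗ g)
  have hdet : ∀ s, MvPolynomial.eval s (Matrix.det (Matrix.of f)) =
      Matrix.det (Matrix.of fun i => g (x s i)) := by
    intro s
    rw [RingHom.map_det]
    congr 1
    ext i j
    simpa using (hf i j s).symm
  refine ⟨Matrix.det (Matrix.of f), fun h => ?_, fun s hs => ?_⟩
  · have h1 := hdet s₀
    have : (Matrix.of fun i => g (x s₀ i)) = 1 := by
      ext i j
      have := congrArg (fun v => v j) (LinearMap.congr_fun hg (Pi.single i 1))
      simpa [Fintype.linearCombination_apply_single, Matrix.one_apply, Pi.single_apply,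
        eq_comm] using this
    rw [this, h, Matrix.det_one, map_zero] at h1
    exact zero_ne_one h1
  · rw [hdet] at hs
    have := Matrix.linearIndependent_rows_iff_isUnit.2
      ((Matrix.isUnit_iff_isUnit_det _).2 hs.isUnit)
    exact LinearIndependent.of_comp g this

end Generic

/-! ### The linear system of a colored graph -/

theorem finrank_real_fun_complex (X : Type*) [Finite X] :
    Module.finrank ℝ (X → ℂ) = 2 * Nat.card X := by
  have := Fintype.ofFinite X
  rw [Module.finrank_pi_fintype]
  simp [mul_comm]

theorem coneRotation_apply {k : ℕ} [NeZero k] (g : ZMod k) (z : ℂ) :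
    coneRotation k g z = (ZMod.toCircle g : ℂ) * z := by
  simp [coneRotation, rotation_apply]

theorem coneRotation_zero {k : ℕ} [NeZero k] (z : ℂ) : coneRotation k 0 z = z := by
  simp [coneRotation_apply]

theorem coneRotation_add {k : ℕ} [NeZero k] (g h : ZMod k) (z : ℂ) :
    coneRotation k (g + h) z = coneRotation k g (coneRotation k h z) := by
  simp [coneRotation_apply, AddChar.map_add_eq_mul, mul_assoc]

namespace ColoredGraph

open Module

variable {k : ℕ} {V E : Type*}

theorem boundary_single [Fintype E] [DecidableEq E] [DecidableEq V] (G : ColoredGraph k V E)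
    (e : E) : G.boundary (Pi.single e 1) = Pi.single (G.head e) 1 - Pi.single (G.tail e) 1 := by
  ext v
  simp [boundary, Pi.single_apply, eq_comm]

theorem rho_single [Fintype E] [DecidableEq E] (G : ColoredGraph k V E) (e : E) :
    G.rho (Pi.single e 1) = G.color e := by
  simp [rho, Pi.single_apply]

theorem tail_mem_verts {G : ColoredGraph k V E} {F : Finset E}
    {e : E} (he : e ∈ F) : G.tail e ∈ G.verts F :=
  ⟨e, he, Or.inl rfl⟩

theorem head_mem_verts {G : ColoredGraph k V E} {F : Finset E}
    {e : E} (he : e ∈ F) : G.head e ∈ G.verts F :=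
  ⟨e, he, Or.inr rfl⟩

theorem connectedComponentMk_head_eq_tail {G : ColoredGraph k V E} {F : Finset E}
    {e : E} (he : e ∈ F) :
    (G.underlying F).connectedComponentMk ⟨G.head e, head_mem_verts he⟩ =
      (G.underlying F).connectedComponentMk ⟨G.tail e, tail_mem_verts he⟩ := by
  by_cases h : G.head e = G.tail e
  · congr 2
  · refine SimpleGraph.ConnectedComponent.sound (SimpleGraph.Adj.reachable ?_)
    rw [underlying, SimpleGraph.fromRel_adj]
    exact ⟨fun h' => h (congrArg Subtype.val h'), Or.inr ⟨e, he, rfl, rfl⟩⟩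

theorem numNontrivial_add_numTrivial [Finite V] [Fintype E] (G : ColoredGraph k V E)
    (F : Finset E) : G.numNontrivial F + G.numTrivial F = Nat.card (G.Component F) := by
  classical
  rw [add_comm]
  have := Fintype.ofFinite (G.Component F)
  rw [numNontrivial, numTrivial, Nat.card_eq_fintype_card, Nat.card_eq_fintype_card,
    Nat.card_eq_fintype_card, ← Fintype.card_sum]
  exact Fintype.card_congr (Equiv.sumCompl _)

variable [NeZero k]

/-- The displacement between the endpoints of the lift of an edge in a symmetric placement. -/
noncomputable def displacement (G : ColoredGraph k V E) (e : E) : (V → ℂ) →ₗ[ℝ] ℂ :=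
  (coneRotation k (G.color e)).toLinearEquiv.toLinearMap ∘ₗ LinearMap.proj (φ := fun _ => ℂ) (G.head e) -
    LinearMap.proj (G.tail e)

theorem displacement_apply (G : ColoredGraph k V E) (e : E) (p : V → ℂ) :
    G.displacement e p = coneRotation k (G.color e) (p (G.head e)) - p (G.tail e) := rfl

/-- The linear form on symmetric placements that makes an edge parallel to a direction. -/
noncomputable def edgeForm (G : ColoredGraph k V E) (e : E) : ℂ →ₗ[ℝ] Dual ℝ (V → ℂ) :=
  LinearMap.mk₂ ℝ (fun d p => ⟪G.displacement e p, Complex.I * d⟫_ℝ)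
    (fun d d' p => by rw [mul_add, inner_add_right])
    (fun c d p => by rw [mul_smul_comm, inner_smul_right, smul_eq_mul])
    (fun d p p' => by rw [map_add, inner_add_left])
    (fun c d p => by rw [map_smul, real_inner_smul_left, smul_eq_mul])

theorem edgeForm_apply (G : ColoredGraph k V E) (e : E) (d : ℂ) (p : V → ℂ) :
    G.edgeForm e d p = ⟪G.displacement e p, Complex.I * d⟫_ℝ := rfl

theorem edgeForm_eq (G : ColoredGraph k V E) (e : E) (d : ℂ) :
    G.edgeForm e d = d.re • G.edgeForm e 1 + d.im • G.edgeForm e Complex.I := by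
  rw [← map_smul, ← map_smul, ← map_add]
  congr 1
  simp

open Classical in
/-- The linear forms of an edge in the two coordinate directions. -/
noncomputable def coordForms (G : ColoredGraph k V E) (e : E) : Finset (Dual ℝ (V → ℂ)) :=
  {G.edgeForm e 1, G.edgeForm e Complex.I}

theorem mem_coordForms {G : ColoredGraph k V E} {e : E} {φ : Dual ℝ (V → ℂ)} :
    φ ∈ G.coordForms e ↔ φ = G.edgeForm e 1 ∨ φ = G.edgeForm e Complex.I := by
  simp [coordForms]

/-- The directions `1` and `I` read off the imaginary part and minus the real part of the
displacement. -/
theorem displacement_eq_zero_iff (G : ColoredGraph k V E) (e : E) (p : V → ℂ) :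
    G.displacement e p = 0 ↔ ∀ φ ∈ G.coordForms e, φ p = 0 := by
  simp only [mem_coordForms, forall_eq_or_imp, forall_eq, edgeForm_apply]
  constructor
  · intro h
    simp [h]
  · intro h
    simp [Complex.inner] at h
    exact Complex.ext (by simpa using h.2) (by simpa using h.1)

/-- The rank of the linear system that collapses every edge in a set. -/
noncomputable def collapseRank (G : ColoredGraph k V E) (F : Finset E) : ℕ :=
  finrank ℝ (familySpan ℝ G.coordForms F)

/-- The symmetric placements that collapse every edge in a set. -/
noncomputable def collapsed (G : ColoredGraph k V E) (F : Finset E) : Submodule ℝ (V → ℂ) :=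
  (familySpan ℝ G.coordForms F).dualCoannihilator

theorem mem_collapsed {G : ColoredGraph k V E} {F : Finset E} {p : V → ℂ} :
    p ∈ G.collapsed F ↔ ∀ e ∈ F, G.displacement e p = 0 := by
  rw [collapsed, Submodule.mem_dualCoannihilator]
  constructor
  · intro h e he
    exact (G.displacement_eq_zero_iff e p).2 fun φ hφ => h φ (subset_familySpan he hφ)
  · intro h φ hφ
    induction hφ using Submodule.span_induction with
    | mem φ hφ =>
      simp only [Set.mem_iUnion, Finset.mem_coe] at hφ
      obtain ⟨e, he, hφ⟩ := hφ
      exact (G.displacement_eq_zero_iff e p).1 (h e he) φ hφ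
    | zero => rfl
    | add φ ψ _ _ hφ hψ => simp [hφ, hψ]
    | smul c φ _ hφ => simp [hφ]

theorem collapseRank_add_finrank_collapsed [Finite V] (G : ColoredGraph k V E) (F : Finset E) :
    G.collapseRank F + finrank ℝ (G.collapsed F) = 2 * Nat.card V := by
  rw [← finrank_real_fun_complex V]
  exact Subspace.finrank_add_finrank_dualCoannihilator_eq _

/-! ### Potentials -/

/-- On a collapsed edge the rotation of the color equals `p (tail) / p (head)`. The product of such
quotients along a cycle telescopes to `1`, and `ZMod.toCircle` is injective. -/
theorem rhoImage_eq_bot_of_ne_zero [Fintype V] [Fintype E] (G : ColoredGraph k V E) {A : Set E}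
    {p : V → ℂ} (h : ∀ e ∈ A, G.displacement e p = 0) (h0 : ∀ e ∈ A, p (G.tail e) ≠ 0) :
    G.rhoImage A = ⊥ := by
  classical
  rw [eq_bot_iff]
  rintro _ ⟨z, ⟨hz, hzA⟩, rfl⟩
  rw [AddSubgroup.mem_bot]
  apply ZMod.injective_toCircle
  rw [← Circle.coe_inj]
  -- The value `1` at zeros of `p` only keeps integer powers invertible; edges outside `A` have
  -- coefficient zero in `z`.
  let q : V → ℂ := fun v => if p v = 0 then 1 else p v
  have hq : ∀ v, q v ≠ 0 := by
    intro v
    by_cases hv : p v = 0 <;> simp [q, hv]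
  have hcol : ∀ e ∈ A, (ZMod.toCircle (G.color e) : ℂ) = q (G.tail e) / q (G.head e) := by
    intro e he
    have h1 := h e he
    have h2 := h0 e he
    rw [displacement_apply, coneRotation_apply, sub_eq_zero] at h1
    have h3 : p (G.head e) ≠ 0 := by
      intro h3
      exact h2 (by rw [← h1, h3, mul_zero])
    simp only [q, h2, h3, if_false]
    rw [eq_div_iff h3, h1]
  have hrho : (ZMod.toCircle (G.rho z) : ℂ) = ∏ e, (ZMod.toCircle (G.color e) : ℂ) ^ z e := by
    have : G.rho z = ∑ e, z e • G.color e := by simp [rho]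
    have hprod : ∀ s : Finset E, (ZMod.toCircle (∑ e ∈ s, z e • G.color e) : ℂ) =
        ∏ e ∈ s, (ZMod.toCircle (G.color e) : ℂ) ^ z e := by
      intro s
      induction s using Finset.induction_on with
      | empty => simp
      | insert a s ha ih =>
        rw [Finset.sum_insert ha, Finset.prod_insert ha, AddChar.map_add_eq_mul, Circle.coe_mul,
          ih, AddChar.map_zsmul_eq_zpow, Circle.coe_zpow]
    rw [this, hprod]
  -- Telescoping is the evaluation of this product in two ways: by vertices, where the boundary
  -- vanishes, and by edges.
  have hbd : ∏ v, q v ^ (G.boundary z v) = 1 := by simp [hz]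
  have hswap : ∏ v, q v ^ (G.boundary z v) = ∏ e, (q (G.head e) / q (G.tail e)) ^ z e := by
    have : ∀ v, q v ^ (G.boundary z v) =
        ∏ e, (q v ^ ((if G.head e = v then (1 : ℤ) else 0) -
          (if G.tail e = v then 1 else 0))) ^ z e := by
      intro v
      simp only [← zpow_mul]
      have hsum : ∀ (s : Finset E) (f : E → ℤ), q v ^ (∑ e ∈ s, f e) = ∏ e ∈ s, q v ^ f e := by
        intro s f
        induction s using Finset.induction_on with
        | empty => simp
        | insert a s ha ih => rw [Finset.sum_insert ha, Finset.prod_insert ha, zpow_add₀ (hq v), ih]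
      rw [← hsum]
      congr 1
      simp only [boundary, AddMonoidHom.coe_mk, ZeroHom.coe_mk]
      exact Finset.sum_congr rfl fun e _ => by rw [mul_comm]
    simp only [this]
    rw [Finset.prod_comm]
    refine Finset.prod_congr rfl fun e _ => ?_
    rw [Finset.prod_zpow]
    congr 1
    simp only [zpow_sub₀ (hq _), Finset.prod_div_distrib]
    congr 1 <;>
    · rw [Finset.prod_eq_single_of_mem _ (Finset.mem_univ _)
        (fun v _ hv => by rw [if_neg (Ne.symm hv), zpow_zero])]
      simp
  have hinv : ∏ e, (ZMod.toCircle (G.color e) : ℂ) ^ z e =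
      (∏ e, (q (G.head e) / q (G.tail e)) ^ z e)⁻¹ := by
    rw [← Finset.prod_inv_distrib]
    refine Finset.prod_congr rfl fun e _ => ?_
    by_cases he : e ∈ A
    · rw [hcol e he, ← inv_zpow, inv_div]
    · simp [hzA e he]
  rw [hrho, hinv, ← hswap, hbd]
  simp

/-- Because `ρ` kills the cycles in `A`, the color sum of a chain in `A` depends only on its
boundary. This homomorphism into the circle `ℝ/ℤ` extends to all 0-chains since a divisible group is
injective, and its values on vertices are the angles of a potential. -/
theorem exists_potential_of_rhoImage_eq_bot [Fintype E] (G : ColoredGraph k V E) {A : Set E}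
    (hA : G.rhoImage A = ⊥) :
    ∃ p : V → ℂ, (∀ v, p v ≠ 0) ∧ ∀ e ∈ A, G.displacement e p = 0 := by
  classical
  -- Truncation of chains to `A`.
  let r : (E → ℤ) →ₗ[ℤ] (E → ℤ) :=
    LinearMap.pi fun e => if e ∈ A then LinearMap.proj e else 0
  have hr : ∀ z e, r z e = if e ∈ A then z e else 0 := by
    intro z e
    by_cases he : e ∈ A <;> simp [r, he]
  let b : (E → ℤ) →ₗ[ℤ] (V → ℤ) := G.boundary.toIntLinearMap ∘ₗ r
  let c : (E → ℤ) →ₗ[ℤ] UnitAddCircle :=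
    ((ZMod.toAddCircle (N := k)).comp G.rho).toIntLinearMap ∘ₗ r
  have hbc : LinearMap.ker b ≤ LinearMap.ker c := by
    intro z hz
    have hmem : G.rho (r z) ∈ G.rhoImage A :=
      ⟨r z, ⟨hz, fun e he => by simp [hr, he]⟩, rfl⟩
    rw [hA, AddSubgroup.mem_bot] at hmem
    rw [LinearMap.mem_ker]
    simp [c, hmem]
  obtain ⟨θ, hθ⟩ := (Module.Baer.of_divisible UnitAddCircle).extension_property
    ((LinearMap.ker b).liftQ b le_rfl) (LinearMap.ker_eq_bot.1 (Submodule.ker_liftQ_eq_bot _ _ _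
      le_rfl)) ((LinearMap.ker b).liftQ c hbc)
  have hθ' : ∀ z, θ (b z) = c z := fun z => by
    simpa using LinearMap.congr_fun hθ (Submodule.Quotient.mk z)
  -- The sign is forced: `θ (head) - θ (tail)` is the color, and rotating the head by the color must
  -- give the tail.
  refine ⟨fun v => (AddCircle.toCircle (-θ (Pi.single v 1)) : ℂ), fun v => Circle.coe_ne_zero _,
    fun e he => ?_⟩
  have h1 := hθ' (Pi.single e 1)
  have hre : r (Pi.single e 1) = Pi.single e 1 := by
    ext e'
    rw [hr]
    by_cases h : e' = e
    · simp [h, he]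
    · simp [h]
  simp only [b, c, LinearMap.comp_apply, hre, AddMonoidHom.coe_toIntLinearMap,
    AddMonoidHom.comp_apply, boundary_single, rho_single, map_sub] at h1
  have hcirc : (ZMod.toCircle (G.color e) : Circle) =
      AddCircle.toCircle (ZMod.toAddCircle (G.color e)) := rfl
  rw [displacement_apply, coneRotation_apply, sub_eq_zero, hcirc, ← Circle.coe_mul,
    ← AddCircle.toCircle_add, ← h1]
  congr 2
  abel

/-! ### The rank of a set of edges -/

/-- Any placement that vanishes on `W` collapses all edges inside `W`. -/
theorem two_mul_le_finrank_collapsed [Finite V] (G : ColoredGraph k V E) (F : Finset E)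
    (W : Set V) (hW : ∀ e ∈ F, G.tail e ∈ W ∧ G.head e ∈ W) :
    2 * Nat.card V ≤ finrank ℝ (G.collapsed F) + 2 * Nat.card W := by
  classical
  let f : (V → ℂ) →ₗ[ℝ] (W → ℂ) := LinearMap.funLeft ℝ ℂ Subtype.val
  have h1 := f.finrank_range_add_finrank_ker
  have h2 : finrank ℝ (LinearMap.range f) ≤ finrank ℝ (W → ℂ) := Submodule.finrank_le _
  have h3 : LinearMap.ker f ≤ G.collapsed F := by
    intro p hp
    have hp : ∀ v ∈ W, p v = 0 := fun v hv => congrFun (LinearMap.mem_ker.1 hp) ⟨v, hv⟩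
    refine mem_collapsed.2 fun e he => ?_
    rw [displacement_apply, hp _ (hW e he).1, hp _ (hW e he).2, map_zero, sub_zero]
  have h4 := Submodule.finrank_mono h3
  rw [finrank_real_fun_complex] at h1 h2
  omega

/-- With trivial `ρ`, the complex multiples of a potential on `W` also collapse `F`, which gains two
real dimensions. -/
theorem two_mul_add_two_le_finrank_collapsed [Finite V] [Fintype E] (G : ColoredGraph k V E)
    (F : Finset E) (W : Set V) (hW : ∀ e ∈ F, G.tail e ∈ W ∧ G.head e ∈ W)
    (hW0 : W.Nonempty) (hF : G.rhoImage (F : Set E) = ⊥) :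
    2 * Nat.card V + 2 ≤ finrank ℝ (G.collapsed F) + 2 * Nat.card W := by
  classical
  obtain ⟨q, hq, hqF⟩ := G.exists_potential_of_rhoImage_eq_bot hF
  obtain ⟨w, hw⟩ := hW0
  -- restrict to `W` modulo the multiples of the potential
  let f : (V → ℂ) →ₗ[ℝ] ({v : W // v.1 ≠ w} → ℂ) := LinearMap.pi fun v =>
    LinearMap.proj v.1.1 - (LinearMap.mulLeft ℝ (q v.1.1 / q w)) ∘ₗ LinearMap.proj (φ := fun _ => ℂ) w
  have hf : ∀ p v, f p v = p v.1.1 - q v.1.1 / q w * p w := fun p v => rfl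
  have h1 := f.finrank_range_add_finrank_ker
  have h2 : finrank ℝ (LinearMap.range f) ≤ finrank ℝ ({v : W // v.1 ≠ w} → ℂ) :=
    Submodule.finrank_le _
  have h3 : LinearMap.ker f ≤ G.collapsed F := by
    intro p hp
    have hp : ∀ v ∈ W, p v = q v / q w * p w := by
      intro v hv
      by_cases hvw : v = w
      · rw [hvw, div_self (hq w), one_mul]
      · have := congrFun (LinearMap.mem_ker.1 hp) ⟨⟨v, hv⟩, hvw⟩
        rw [hf] at this
        exact sub_eq_zero.1 this
    refine mem_collapsed.2 fun e he => ?_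
    have h := hqF e he
    rw [displacement_apply, coneRotation_apply] at h ⊢
    rw [hp _ (hW e he).1, hp _ (hW e he).2]
    linear_combination (p w / q w) * h
  have h4 := Submodule.finrank_mono h3
  have h5 : Nat.card {v : W // v.1 ≠ w} + 1 = Nat.card W := by
    have := Fintype.ofFinite V
    have h6 := Fintype.card_subtype_compl (fun v : W => v = ⟨w, hw⟩)
    have h7 : 0 < Fintype.card W := Fintype.card_pos_iff.2 ⟨⟨w, hw⟩⟩
    rw [Fintype.card_subtype_eq] at h6
    have h8 : Nat.card {v : W // v.1 ≠ w} = Fintype.card {v : W // ¬ v = ⟨w, hw⟩} := by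
      rw [← Nat.card_eq_fintype_card]
      exact Nat.card_congr (Equiv.subtypeEquivRight fun v => by simp [Subtype.ext_iff])
    rw [h8, h6, Nat.card_eq_fintype_card]
    omega
  rw [finrank_real_fun_complex] at h1 h2
  omega

variable {G : ColoredGraph k V E} {F : Finset E}

theorem ne_zero_of_reachable {p : V → ℂ} (hp : p ∈ G.collapsed F) {u v : G.verts F}
    (h : (G.underlying F).Reachable u v) (hu : p u ≠ 0) : p v ≠ 0 := by
  have hne : ∀ e ∈ F, (p (G.tail e) ≠ 0 ↔ p (G.head e) ≠ 0) := by
    intro e he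
    have := mem_collapsed.1 hp e he
    rw [displacement_apply, sub_eq_zero] at this
    rw [← this]
    simp
  obtain ⟨w⟩ := h
  induction w with
  | nil => exact hu
  | cons hadj _ ih =>
    refine ih ?_
    rw [underlying, SimpleGraph.fromRel_adj] at hadj
    obtain ⟨-, ⟨e, he, h1, h2⟩ | ⟨e, he, h1, h2⟩⟩ := hadj
    · rw [← h2]; rw [← h1] at hu; exact (hne e he).1 hu
    · rw [← h1]; rw [← h2] at hu; exact (hne e he).2 hu

/-- A collapsing placement is determined by its values off `G.verts F` and at one vertex of each
component with trivial `ρ`: being nonzero spreads along a component, and then forces `ρ` to be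
trivial there. -/
theorem finrank_collapsed_le [Fintype V] [Fintype E] (G : ColoredGraph k V E) (F : Finset E) :
    finrank ℝ (G.collapsed F) + 2 * Nat.card (G.verts F) ≤
      2 * Nat.card V + 2 * G.numTrivial F := by
  classical
  let C := {c : G.Component F // G.rhoImage (G.compEdges F c) = ⊥}
  let f : (V → ℂ) →ₗ[ℝ] (((G.verts F)ᶜ : Set V) → ℂ) × (C → ℂ) :=
    (LinearMap.funLeft ℝ ℂ Subtype.val).prod (LinearMap.funLeft ℝ ℂ fun c => c.1.out.1)
  have hinj : Function.Injective (f.domRestrict (G.collapsed F)) := by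
    rw [← LinearMap.ker_eq_bot, LinearMap.ker_eq_bot']
    rintro ⟨p, hp⟩ h0
    have h1 : ∀ v ∉ G.verts F, p v = 0 := fun v hv =>
      congrFun (congrArg Prod.fst h0) ⟨v, hv⟩
    have h2 : ∀ c : C, p c.1.out.1 = 0 := fun c => congrFun (congrArg Prod.snd h0) c
    ext v
    by_contra hv
    have hvF : v ∈ G.verts F := by
      by_contra hvF
      exact hv (h1 v hvF)
    let c := (G.underlying F).connectedComponentMk ⟨v, hvF⟩
    have hc : ∀ u ∈ c.supp, p u.1 ≠ 0 := fun u hu =>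
      ne_zero_of_reachable hp (SimpleGraph.ConnectedComponent.exact hu).symm hv
    have hbal : G.rhoImage (G.compEdges F c) = ⊥ := by
      refine G.rhoImage_eq_bot_of_ne_zero (fun e he => mem_collapsed.1 hp e he.1) ?_
      rintro e ⟨-, u, hu, hue⟩
      rw [hue]
      exact hc u hu
    exact hc c.out (Quot.out_eq c) (h2 ⟨c, hbal⟩)
  have h1 := LinearMap.finrank_le_finrank_of_injective hinj
  rw [Module.finrank_prod, finrank_real_fun_complex, finrank_real_fun_complex] at h1
  have h2 : Nat.card (G.verts F) + Nat.card ((G.verts F)ᶜ : Set V) = Nat.card V := by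
    rw [Nat.card_coe_set_eq, Nat.card_coe_set_eq, Set.ncard_add_ncard_compl]
  have h3 : Nat.card C = G.numTrivial F := rfl
  omega

end ColoredGraph

namespace ColoredGraph

open Module

variable {k : ℕ} [NeZero k] {V E : Type*}

/-! ### Cone-Laman graphs and the collapse rank -/

/-- The rank is at least `2n' - 2c'₀`, and the count stays below this by the number of components,
which is positive. -/
theorem card_lt_collapseRank_of_isConeLaman [Fintype V] [Fintype E] {G : ColoredGraph k V E}
    (hG : G.IsConeLaman) {F : Finset E} (hF : F.Nonempty) : F.card < G.collapseRank F := by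
  have h1 := hG.2 F
  have h2 := G.finrank_collapsed_le F
  have h3 := G.collapseRank_add_finrank_collapsed F
  have h4 := G.numNontrivial_add_numTrivial F
  obtain ⟨e, he⟩ := hF
  have : Nonempty (G.Component F) :=
    ⟨(G.underlying F).connectedComponentMk ⟨G.tail e, tail_mem_verts he⟩⟩
  have h5 : 0 < Nat.card (G.Component F) := Nat.card_pos
  omega

/-- The strict inequality is applied to each component separately, so that every component
contributes its own unit of slack to the sum. -/
theorem card_le_of_forall_card_lt_collapseRank [Fintype V] [Fintype E] (G : ColoredGraph k V E)
    (h : ∀ F : Finset E, F.Nonempty → F.card < G.collapseRank F) (F : Finset E) :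
    (F.card : ℤ) ≤ 2 * (Nat.card (G.verts F) : ℤ) - (G.numNontrivial F : ℤ) -
      3 * (G.numTrivial F : ℤ) := by
  classical
  have := Fintype.ofFinite (G.Component F)
  let comp : F → G.Component F := fun e =>
    (G.underlying F).connectedComponentMk ⟨G.tail e, tail_mem_verts e.2⟩
  let Fc : G.Component F → Finset E := fun c => F.filter fun e => e ∈ G.compEdges F c
  have hFc : ∀ c, (Fc c : Set E) = G.compEdges F c := by
    intro c
    ext e
    simp only [Fc, Finset.coe_filter, Set.mem_ofPred_eq]
    exact ⟨fun h => h.2, fun h => ⟨h.1, h⟩⟩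
  have hmem : ∀ (c : G.Component F) (e : F), e.1 ∈ Fc c ↔ comp e = c := by
    intro c e
    rw [← Finset.mem_coe, hFc]
    constructor
    · rintro ⟨-, v, hv, hev⟩
      have : v = ⟨G.tail e, tail_mem_verts e.2⟩ := Subtype.ext hev.symm
      rw [this] at hv
      exact hv
    · intro hc
      exact ⟨e.2, ⟨G.tail e, tail_mem_verts e.2⟩, hc, rfl⟩
  have hsumF : F.card = ∑ c, (Fc c).card := by
    rw [← Fintype.card_coe F, ← Finset.card_univ,
      Finset.card_eq_sum_card_fiberwise (f := comp) (t := Finset.univ) (fun _ _ => by simp)]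
    refine Finset.sum_congr rfl fun c _ => ?_
    refine Finset.card_bij (fun e _ => e.1) ?_ ?_ ?_
    · intro e he
      exact (hmem c e).2 (by simpa using he)
    · intro e _ e' _ hee
      exact Subtype.ext hee
    · intro e he
      have heF : e ∈ F := (Finset.mem_filter.1 he).1
      exact ⟨⟨e, heF⟩, by simpa using (hmem c ⟨e, heF⟩).1 he, rfl⟩
  have hsumV : Nat.card (G.verts F) = ∑ c : G.Component F, Nat.card c.supp := by
    have e := Equiv.sigmaFiberEquiv (G.underlying F).connectedComponentMk
    rw [← Nat.card_congr e, Nat.card_sigma]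
    rfl
  have hsumT : G.numTrivial F =
      ∑ c : G.Component F, if G.rhoImage (G.compEdges F c) = ⊥ then 1 else 0 := by
    rw [numTrivial, Nat.card_eq_fintype_card, Fintype.card_subtype, Finset.card_filter]
  have hcomp : ∀ c : G.Component F, (Fc c).card + 1 +
      2 * (if G.rhoImage (G.compEdges F c) = ⊥ then 1 else 0) ≤ 2 * Nat.card c.supp := by
    intro c
    obtain ⟨⟨v, hv⟩, hvc⟩ := c.nonempty_supp
    -- There are no isolated vertices: every vertex of `G.verts F` is an endpoint of an edge of `F`.
    have hne : (Fc c).Nonempty := by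
      obtain ⟨e, he, hev⟩ := hv
      refine ⟨e, (hmem c ⟨e, he⟩).2 ?_⟩
      rw [← show _ = c from hvc]
      rcases hev with rfl | rfl
      · rfl
      · exact (connectedComponentMk_head_eq_tail he).symm
    have h1 := h _ hne
    have h2 := G.collapseRank_add_finrank_collapsed (Fc c)
    have hW : ∀ e ∈ Fc c, G.tail e ∈ Subtype.val '' c.supp ∧
        G.head e ∈ Subtype.val '' c.supp := by
      intro e he
      have heF : e ∈ F := (Finset.mem_filter.1 he).1
      have hc := (hmem c ⟨e, heF⟩).1 he
      exact ⟨⟨_, hc, rfl⟩, ⟨_, (connectedComponentMk_head_eq_tail heF).trans hc, rfl⟩⟩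
    have hcard : Nat.card (Subtype.val '' c.supp : Set V) = Nat.card c.supp :=
      Nat.card_image_of_injective Subtype.val_injective _
    split_ifs with hb
    · have h3 := G.two_mul_add_two_le_finrank_collapsed (Fc c) _ hW ⟨v, _, hvc, rfl⟩
        (by rw [hFc, hb])
      omega
    · have h3 := G.two_mul_le_finrank_collapsed (Fc c) _ hW
      omega
  have hsum := Finset.sum_le_sum fun c (_ : c ∈ Finset.univ) => hcomp c
  rw [Finset.sum_add_distrib, Finset.sum_add_distrib, ← Finset.mul_sum, ← Finset.mul_sum,
    ← hsumF, ← hsumV, ← hsumT] at hsum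
  have hcount := G.numNontrivial_add_numTrivial F
  rw [Nat.card_eq_fintype_card] at hcount
  simp only [Finset.sum_const, Finset.card_univ, smul_eq_mul, mul_one] at hsum
  omega

/-! ### Generic independence -/

/-- The directions with given real coordinates. -/
def dirs (x : E × Fin 2 → ℝ) (e : E) : ℂ := ⟨x (e, 0), x (e, 1)⟩

theorem dirs_coords (d : E → ℂ) : dirs (SymmetricGraph.coords d) = d := by
  ext e
  simp [dirs, SymmetricGraph.coords]

theorem edgeForm_mem_familySpan (G : ColoredGraph k V E) {F : Finset E} {e : E} (he : e ∈ F)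
    (d : ℂ) : G.edgeForm e d ∈ familySpan ℝ G.coordForms F := by
  rw [edgeForm_eq]
  exact add_mem (Submodule.smul_mem _ _ (subset_familySpan he (mem_coordForms.2 (Or.inl rfl))))
    (Submodule.smul_mem _ _ (subset_familySpan he (mem_coordForms.2 (Or.inr rfl))))

/-- If every subfamily of `F ⊕ X` has large enough rank, then the direction constraints of `F`,
together with suitable fixed constraints on `X`, are generically independent. -/
theorem exists_generically_linearIndependent [Finite V] [DecidableEq E] (G : ColoredGraph k V E)
    (F X : Finset E)
    (h : ∀ F' ⊆ F, ∀ X' ⊆ X, F'.card + X'.card ≤ G.collapseRank (F' ∪ X')) :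
    ∃ φ : X → Dual ℝ (V → ℂ), (∀ e : X, φ e ∈ G.coordForms e.1) ∧
      HoldsGenerically fun x : E × Fin 2 → ℝ => LinearIndependent ℝ
        (Sum.elim (fun e : F => G.edgeForm e.1 (dirs x e.1)) φ) := by
  classical
  -- The index set is a disjoint sum because an edge may lie in both `F` and `X` and then
  -- contributes two forms.
  obtain ⟨y, hy, hyind⟩ := exists_linearIndependent_transversal (K := ℝ)
    (fun i : F ⊕ X => G.coordForms (Sum.elim Subtype.val Subtype.val i)) (by
      intro T
      have h1 := h (T.toLeft.map ⟨_, Subtype.val_injective⟩)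
        (fun e he => by
          obtain ⟨a, -, rfl⟩ := Finset.mem_map.1 he
          exact a.2)
        (T.toRight.map ⟨_, Subtype.val_injective⟩)
        (fun e he => by
          obtain ⟨a, -, rfl⟩ := Finset.mem_map.1 he
          exact a.2)
      rw [Finset.card_map, Finset.card_map, Finset.card_toLeft_add_card_toRight] at h1
      refine h1.trans (Submodule.finrank_mono (Submodule.span_le.2 fun w hw => ?_))
      simp only [Set.mem_iUnion, Finset.mem_union, Finset.mem_coe, Finset.mem_map] at hw
      obtain ⟨e, ⟨a, ha, rfl⟩ | ⟨a, ha, rfl⟩, hw⟩ := hw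
      · exact subset_familySpan (A := fun i : F ⊕ X =>
          G.coordForms (Sum.elim Subtype.val Subtype.val i)) (Finset.mem_toLeft.1 ha) hw
      · exact subset_familySpan (A := fun i : F ⊕ X =>
          G.coordForms (Sum.elim Subtype.val Subtype.val i)) (Finset.mem_toRight.1 ha) hw)
  have hd : ∀ e : F, ∃ d : ℂ, y (Sum.inl e) = G.edgeForm e.1 d := by
    intro e
    rcases mem_coordForms.1 (hy (Sum.inl e)) with h | h
    · exact ⟨_, h⟩
    · exact ⟨_, h⟩
  choose d hd using hd
  refine ⟨fun e : X => y (Sum.inr e), fun e : X => hy (Sum.inr e), ?_⟩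
  -- The transversal selects direction `1` or `I` on each edge of `F`, which is itself a direction
  -- assignment with independent forms; the value `0` off `F` plays no role.
  refine HoldsGenerically.linearIndependent _ ?_
    (s₀ := SymmetricGraph.coords fun e : E => if he : e ∈ F then d ⟨e, he⟩ else 0) ?_
  · rintro (e | e) ψ
    · refine ⟨MvPolynomial.X (e.1, 0) * MvPolynomial.C (ψ (G.edgeForm e.1 1)) +
        MvPolynomial.X (e.1, 1) * MvPolynomial.C (ψ (G.edgeForm e.1 Complex.I)), fun s => ?_⟩
      rw [Sum.elim_inl, edgeForm_eq]
      simp [dirs]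
    · exact ⟨MvPolynomial.C (ψ (y (Sum.inr e))), fun s => by simp⟩
  · rw [dirs_coords]
    have hy' : (Sum.elim (fun e : F => G.edgeForm e.1 (if he : e.1 ∈ F then d ⟨e.1, he⟩ else 0))
        fun e : X => y (Sum.inr e)) = y := by
      ext1 i
      rcases i with e | e
      · simp [hd]
      · rfl
    rw [hy']
    exact hyind

/-- The placements of the vertices that satisfy all direction constraints. -/
noncomputable def realizations (G : ColoredGraph k V E) (d : E → ℂ) : Submodule ℝ (V → ℂ) :=
  (Submodule.span ℝ (Set.range fun e => G.edgeForm e (d e))).dualCoannihilator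

theorem mem_realizations {G : ColoredGraph k V E} {d : E → ℂ} {q : V → ℂ} :
    q ∈ G.realizations d ↔ ∀ e, G.edgeForm e (d e) q = 0 := by
  rw [realizations, Submodule.mem_dualCoannihilator]
  constructor
  · exact fun h e => h _ (Submodule.subset_span ⟨e, rfl⟩)
  · intro h φ hφ
    induction hφ using Submodule.span_induction with
    | mem φ hφ => obtain ⟨e, rfl⟩ := hφ; exact h e
    | zero => rfl
    | add φ ψ _ _ hφ hψ => simp [hφ, hψ]
    | smul c φ _ hφ => simp [hφ]

theorem card_add_finrank_realizations [Finite V] [Fintype E] {G : ColoredGraph k V E} {d : E → ℂ}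
    (h : LinearIndependent ℝ fun e => G.edgeForm e (d e)) :
    Fintype.card E + finrank ℝ (G.realizations d) = 2 * Nat.card V := by
  rw [← finrank_real_fun_complex V, ← finrank_span_eq_card h]
  exact Subspace.finrank_add_finrank_dualCoannihilator_eq _

/-- The quotient form of `SymmetricGraph.HasUniqueFaithfulRealization`. -/
def HasUniqueFaithfulPlacement (G : ColoredGraph k V E) (d : E → ℂ) : Prop :=
  ∃ q ∈ G.realizations d, (∀ e, G.displacement e q ≠ 0) ∧
    ∀ r ∈ G.realizations d, (∀ e, G.displacement e r ≠ 0) → ∃ c : ℝ, r = c • q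

/-- Faithfulness is an open condition on lines through `q`: for any realization `r`, all but
finitely many `q + t • r` are faithful, hence multiples of `q`, and one such `t ≠ 0` makes `r` a
multiple of `q`. -/
theorem HasUniqueFaithfulPlacement.finrank_le_one [Finite E] {G : ColoredGraph k V E} {d : E → ℂ}
    (h : G.HasUniqueFaithfulPlacement d) : finrank ℝ (G.realizations d) ≤ 1 := by
  obtain ⟨q, hq, hfaith, huniq⟩ := h
  refine _root_.finrank_le_one (⟨q, hq⟩ : G.realizations d) fun ⟨r, hr⟩ => ?_
  have hfin : (⋃ e, {t : ℝ | G.displacement e (q + t • r) = 0} ∪ {0}).Finite := by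
    cases isEmpty_or_nonempty E
    · simp
    refine Set.finite_iUnion fun e => Set.Finite.union (Set.Subsingleton.finite ?_)
      (Set.finite_singleton 0)
    intro t ht t' ht'
    simp only [Set.mem_ofPred_eq, map_add, map_smul] at ht ht'
    by_contra hne
    have h1 : (t - t') • G.displacement e r = 0 := by
      rw [sub_smul, sub_eq_zero]
      exact add_left_cancel (ht.trans ht'.symm)
    have h2 : G.displacement e r = 0 := (smul_eq_zero.1 h1).resolve_left (sub_ne_zero.2 hne)
    rw [h2, smul_zero, add_zero] at ht
    exact hfaith e ht
  -- Zero is excluded again because the union over the edges is empty when there are none.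
  obtain ⟨t, ht⟩ := (hfin.union (Set.finite_singleton (0 : ℝ))).infinite_compl.nonempty
  simp only [Set.mem_compl_iff, Set.mem_union, Set.mem_iUnion, Set.mem_ofPred_eq,
    Set.mem_singleton_iff, not_or, not_exists] at ht
  obtain ⟨c, hc⟩ := huniq (q + t • r) (add_mem hq (Submodule.smul_mem _ _ hr))
    fun e => (ht.1 e).1
  refine ⟨t⁻¹ * (c - 1), Subtype.ext ?_⟩
  have : t • r = (c - 1) • q := by rw [sub_smul, one_smul, ← hc]; abel
  change (t⁻¹ * (c - 1)) • q = r
  rw [mul_smul, ← this, inv_smul_smul₀ ht.2]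

theorem generically_linearIndependent [Finite V] [DecidableEq E] (G : ColoredGraph k V E)
    {F : Finset E} (h : ∀ F' ⊆ F, F'.card ≤ G.collapseRank F') :
    HoldsGenerically fun x : E × Fin 2 → ℝ => LinearIndependent ℝ fun e : F => G.edgeForm e.1 (dirs x e.1) := by
  obtain ⟨φ, -, hφ⟩ := G.exists_generically_linearIndependent F ∅ (by
    intro F' hF' X' hX'
    rw [Finset.subset_empty.1 hX']
    simpa using h F' hF')
  refine hφ.mono fun x hx => ?_
  have := hx.comp Sum.inl Sum.inl_injective
  rwa [Sum.elim_comp_inl] at this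

theorem generically_linearIndependent_univ [Finite V] [Fintype E] (G : ColoredGraph k V E)
    (h : ∀ F : Finset E, F.Nonempty → F.card < G.collapseRank F) :
    HoldsGenerically fun x => LinearIndependent ℝ fun e => G.edgeForm e (dirs x e) := by
  classical
  refine (G.generically_linearIndependent (F := Finset.univ) fun F _ => ?_).mono fun x hx =>
    hx.comp (fun e => ⟨e, Finset.mem_univ e⟩) fun e e' h => congrArg Subtype.val h
  rcases F.eq_empty_or_nonempty with rfl | hF
  · simp
  · exact (h F hF).le

/-- In a sparse colored graph, fixing one more constraint on any edge generically leaves only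
trivial realizations, so that no edge is collapsed. -/
theorem generically_displacement_ne_zero [Finite V] [Fintype E] (G : ColoredGraph k V E)
    (hm : Fintype.card E + 1 = 2 * Nat.card V)
    (h : ∀ F : Finset E, F.Nonempty → F.card < G.collapseRank F) (e : E) :
    HoldsGenerically fun x => ∀ q ∈ G.realizations (dirs x), q ≠ 0 → G.displacement e q ≠ 0 := by
  classical
  obtain ⟨φ, hφ, hind⟩ := G.exists_generically_linearIndependent Finset.univ {e} (by
    intro F' _ X' hX'
    rcases (F' ∪ X').eq_empty_or_nonempty with h0 | hne
    · rw [Finset.union_eq_empty] at h0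
      simp [h0.1, h0.2]
    · by_cases hF' : F'.Nonempty
      · have h1 := h F' hF'
        have h2 : G.collapseRank F' ≤ G.collapseRank (F' ∪ X') :=
          Submodule.finrank_mono (familySpan_mono_right Finset.subset_union_left)
        have h3 := Finset.card_le_card hX'
        rw [Finset.card_singleton] at h3
        omega
      · rw [Finset.not_nonempty_iff_eq_empty] at hF'
        subst hF'
        rw [Finset.empty_union] at hne ⊢
        simpa using (h X' hne).le)
  refine hind.mono fun x hx q hq hq0 he => hq0 ?_
  -- The `m + 1 = 2n` independent forms span the dual, and all of them vanish at a realization that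
  -- collapses `e`.
  have htop := hx.span_eq_top_of_card_eq_finrank' (by
    rw [Subspace.dual_finrank_eq, finrank_real_fun_complex, Fintype.card_sum]
    simpa using hm)
  have hall : ∀ ψ : Dual ℝ (V → ℂ), ψ q = 0 := by
    intro ψ
    have hψ : ψ ∈ Submodule.span ℝ (Set.range
        (Sum.elim (fun e : (Finset.univ : Finset E) => G.edgeForm e.1 (dirs x e.1)) φ)) := by
      rw [htop]; trivial
    induction hψ using Submodule.span_induction with
    | mem ψ hψ =>
      obtain ⟨i | i, rfl⟩ := hψ
      · exact mem_realizations.1 hq i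
      · refine (G.displacement_eq_zero_iff i q).1 ?_ _ (hφ i)
        rw [Finset.mem_singleton.1 i.2, he]
    | zero => rfl
    | add φ ψ _ _ hφ hψ => simp [hφ, hψ]
    | smul c φ _ hφ => simp [hφ]
  exact (Module.forall_dual_apply_eq_zero_iff ℝ q).1 hall

theorem generically_hasUniqueFaithfulPlacement [Finite V] [Fintype E] (G : ColoredGraph k V E)
    (hm : Fintype.card E + 1 = 2 * Nat.card V)
    (h : ∀ F : Finset E, F.Nonempty → F.card < G.collapseRank F) :
    HoldsGenerically fun x => G.HasUniqueFaithfulPlacement (dirs x) := by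
  refine ((G.generically_linearIndependent_univ h).and
    (HoldsGenerically.forall (G.generically_displacement_ne_zero hm h))).mono ?_
  rintro x ⟨hx, hne⟩
  have hdim := card_add_finrank_realizations hx
  obtain ⟨⟨q, hq⟩, hq0, hspan⟩ := finrank_eq_one_iff'.1
    (show finrank ℝ (G.realizations (dirs x)) = 1 by omega)
  have hq0 : q ≠ 0 := fun h => hq0 (Subtype.ext h)
  refine ⟨q, hq, fun e => hne e q hq hq0, fun r hr _ => ?_⟩
  obtain ⟨c, hc⟩ := hspan ⟨r, hr⟩
  exact ⟨c, (congrArg Subtype.val hc).symm⟩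

/-- In a colored graph with a dense set of edges, some edge is generically collapsed in every
realization. -/
theorem generically_exists_displacement_eq_zero [Finite V] (G : ColoredGraph k V E)
    {F : Finset E} (hF : F.Nonempty) (h : G.collapseRank F ≤ F.card) :
    HoldsGenerically fun x => ∃ e, ∀ q ∈ G.realizations (dirs x), G.displacement e q = 0 := by
  classical
  induction hN : F.card using Nat.strong_induction_on generalizing F with
  | _ N ih =>
  subst hN
  by_cases hmin : ∃ F' ⊂ F, F'.Nonempty ∧ G.collapseRank F' ≤ F'.card
  · obtain ⟨F', hss, hne, hF'⟩ := hmin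
    exact ih _ (Finset.card_lt_card hss) hne hF' rfl
  push Not at hmin
  obtain ⟨e, he⟩ := hF
  by_cases hcard : G.collapseRank F = F.card
  · refine (G.generically_linearIndependent (F := F) fun F' hF' => ?_).mono fun x hx =>
      ⟨e, fun q hq => (G.displacement_eq_zero_iff e q).2 fun φ hφ => ?_⟩
    · rcases F'.eq_empty_or_nonempty with rfl | hne
      · simp
      rcases hF'.eq_or_ssubset with rfl | hss
      · exact hcard.ge
      · exact (hmin F' hss hne).le
    -- In the tight case, `|F|` independent forms fill a space of dimension `r(F) = |F|`, so the
    -- direction constraints imply the collapse constraints.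
    · have hspan : Submodule.span ℝ (Set.range fun e : F => G.edgeForm e.1 (dirs x e.1)) =
          familySpan ℝ G.coordForms F := by
        refine Submodule.eq_of_le_of_finrank_le (Submodule.span_le.2 ?_) ?_
        · rintro _ ⟨e', rfl⟩
          exact G.edgeForm_mem_familySpan e'.2 _
        · rw [finrank_span_eq_card hx, Fintype.card_coe]
          exact h
      have hφ' := hspan ▸ subset_familySpan (K := ℝ) he hφ
      have hle : Submodule.span ℝ (Set.range fun e : F => G.edgeForm e.1 (dirs x e.1)) ≤
          Submodule.span ℝ (Set.range fun e => G.edgeForm e (dirs x e)) :=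
        Submodule.span_mono (by rintro _ ⟨e', rfl⟩; exact ⟨e'.1, rfl⟩)
      exact (Submodule.mem_dualCoannihilator _).1 hq φ (hle hφ')
  · have hle : G.collapseRank (F.erase e) ≤ G.collapseRank F :=
      Submodule.finrank_mono (familySpan_mono_right (Finset.erase_subset e F))
    have hc := Finset.card_erase_of_mem he
    -- If `r(F) < |F|`, minimality leaves only `F = {e}` with rank zero: otherwise `|F| - 1 <
    -- r(F.erase e) ≤ r(F) < |F|`. The edge is then collapsed by every placement.
    have hzero : G.collapseRank F = 0 := by
      rcases (F.erase e).eq_empty_or_nonempty with h0 | hne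
      · rw [h0, Finset.card_empty] at hc
        omega
      · have := hmin _ (Finset.erase_ssubset he) hne
        omega
    refine HoldsGenerically.of_forall fun x => ⟨e, fun q _ =>
      (G.displacement_eq_zero_iff e q).2 fun φ hφ => ?_⟩
    have := subset_familySpan (K := ℝ) he hφ
    rw [Submodule.finrank_eq_zero.1 hzero, Submodule.mem_bot] at this
    rw [this, LinearMap.zero_apply]

/-- The cone-Laman condition does not depend on `x`, so in each case both sides are generically true
or generically false. In the sparse case with `m ≠ 2n - 1`, sparsity of the whole edge set gives `m
< 2n`, while uniqueness requires `2n - m ≤ 1`. -/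
theorem generically_hasUniqueFaithfulPlacement_iff [Fintype V] [Nonempty V] [Fintype E]
    (G : ColoredGraph k V E) :
    HoldsGenerically fun x => G.HasUniqueFaithfulPlacement (dirs x) ↔ G.IsConeLaman := by
  have hV : 0 < Nat.card V := Nat.card_pos
  have hV' := Nat.card_eq_fintype_card (α := V)
  by_cases h : ∀ F : Finset E, F.Nonempty → F.card < G.collapseRank F
  · by_cases hm : Fintype.card E + 1 = 2 * Nat.card V
    · have hL : G.IsConeLaman :=
        ⟨by omega, G.card_le_of_forall_card_lt_collapseRank h⟩
      exact (G.generically_hasUniqueFaithfulPlacement hm h).mono fun x hx => iff_of_true hx hL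
    · have hL : ¬ G.IsConeLaman := fun hL => hm (by have := hL.1; omega)
      refine (G.generically_linearIndependent_univ h).mono fun x hx => iff_of_false ?_ hL
      intro hu
      have h1 := hu.finrank_le_one
      have h2 := card_add_finrank_realizations hx
      have h3 : 0 < Fintype.card E := by omega
      have h4 := h Finset.univ (Finset.card_pos.1 h3)
      have h5 := G.collapseRank_add_finrank_collapsed Finset.univ
      rw [Finset.card_univ] at h4
      omega
  · have hL : ¬ G.IsConeLaman := fun hL => h fun F hF => card_lt_collapseRank_of_isConeLaman hL hF
    push Not at h
    obtain ⟨F, hF, hr⟩ := h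
    refine (G.generically_exists_displacement_eq_zero hF hr).mono fun x hx => iff_of_false ?_ hL
    rintro ⟨q, hq, hfaith, -⟩
    obtain ⟨e, he⟩ := hx
    exact hfaith e (he q hq)

end ColoredGraph

/-! ### Passing to the lift -/

namespace SymmetricGraph.Iso

open ColoredGraph

variable {k : ℕ} {V' E' V E : Type*} {S : SymmetricGraph k V' E'}
  {G : ColoredGraph k V E}

theorem onV_eq (Φ : SymmetricGraph.Iso G.lift S) (i : V) (g : ZMod k) :
    Φ.onV (i, g) = S.actV g (Φ.onV (i, 0)) := by
  rw [← Φ.onV_actV]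
  simp [ColoredGraph.lift]

theorem onE_eq (Φ : SymmetricGraph.Iso G.lift S) (e : E) (g : ZMod k) :
    Φ.onE (e, g) = S.actE g (Φ.onE (e, 0)) := by
  rw [← Φ.onE_actE]
  simp [ColoredGraph.lift]

theorem ends_onE_eq (Φ : SymmetricGraph.Iso G.lift S) (e : E) (g : ZMod k) :
    S.ends (Φ.onE (e, g)) =
      s(Φ.onV (G.tail e, g), Φ.onV (G.head e, g + G.color e)) := by
  rw [Φ.ends_onE]
  simp [ColoredGraph.lift]

variable [NeZero k]

/-- The symmetric extension of a function on the representatives of the vertex orbits. -/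
noncomputable def extendV (Φ : SymmetricGraph.Iso G.lift S) (q : V → ℂ) (v : V') : ℂ :=
  coneRotation k (Φ.onV.symm v).2 (q (Φ.onV.symm v).1)

/-- The symmetric extension of a function on the representatives of the edge orbits. -/
noncomputable def extendE (Φ : SymmetricGraph.Iso G.lift S) (d : E → ℂ) (e : E') : ℂ :=
  coneRotation k (Φ.onE.symm e).2 (d (Φ.onE.symm e).1)

theorem extendV_onV (Φ : SymmetricGraph.Iso G.lift S) (q : V → ℂ) (i : V) (g : ZMod k) :
    Φ.extendV q (Φ.onV (i, g)) = coneRotation k g (q i) := by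
  simp [extendV]

theorem extendE_onE (Φ : SymmetricGraph.Iso G.lift S) (d : E → ℂ) (e : E) (g : ZMod k) :
    Φ.extendE d (Φ.onE (e, g)) = coneRotation k g (d e) := by
  simp [extendE]

theorem extendV_actV (Φ : SymmetricGraph.Iso G.lift S) (q : V → ℂ) (g : ZMod k) (v : V') :
    Φ.extendV q (S.actV g v) = coneRotation k g (Φ.extendV q v) := by
  obtain ⟨⟨i, h⟩, rfl⟩ := Φ.onV.surjective v
  rw [← Φ.onV_actV]
  simp only [ColoredGraph.lift, extendV_onV, coneRotation_add]

theorem extendE_mem_directions (Φ : SymmetricGraph.Iso G.lift S) (d : E → ℂ) :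
    Φ.extendE d ∈ S.Directions := by
  intro g e
  obtain ⟨⟨i, h⟩, rfl⟩ := Φ.onE.surjective e
  rw [← Φ.onE_actE]
  simp only [ColoredGraph.lift, extendE_onE, coneRotation_add]

/-- Rotations preserve the inner product and commute with multiplication by `I`, so all edges in an
orbit impose the same condition. -/
theorem isRealization_extendV_iff (Φ : SymmetricGraph.Iso G.lift S) {d : E' → ℂ}
    (hd : d ∈ S.Directions) (q : V → ℂ) :
    S.IsRealization d (Φ.extendV q) ↔ q ∈ G.realizations fun e => d (Φ.onE (e, 0)) := by
  have key : ∀ e g, ⟪Φ.extendV q (Φ.onV (G.head e, g + G.color e)) -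
      Φ.extendV q (Φ.onV (G.tail e, g)), Complex.I * d (Φ.onE (e, g))⟫_ℝ =
      G.edgeForm e (d (Φ.onE (e, 0))) q := by
    intro e g
    have hrot : Complex.I * coneRotation k g (d (Φ.onE (e, 0))) =
        coneRotation k g (Complex.I * d (Φ.onE (e, 0))) := by
      rw [coneRotation_apply, coneRotation_apply, mul_left_comm]
    rw [extendV_onV, extendV_onV, coneRotation_add, ← map_sub, Φ.onE_eq, hd, hrot,
      LinearIsometryEquiv.inner_map_map, edgeForm_apply, displacement_apply]
  rw [mem_realizations]
  constructor
  · intro h e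
    rw [← key e 0]
    exact h.1 _ _ _ (Φ.ends_onE_eq e 0)
  · refine fun h => ⟨?_, Φ.extendV_actV q⟩
    intro e i j hij
    obtain ⟨⟨e, g⟩, rfl⟩ := Φ.onE.surjective e
    rw [Φ.ends_onE_eq, Sym2.eq_iff] at hij
    rcases hij with ⟨rfl, rfl⟩ | ⟨rfl, rfl⟩
    · rw [key, h]
    · rw [← neg_sub, inner_neg_left, key, h, neg_zero]

theorem isFaithful_extendV_iff (Φ : SymmetricGraph.Iso G.lift S) (q : V → ℂ) :
    S.IsFaithful (Φ.extendV q) ↔ ∀ e, G.displacement e q ≠ 0 := by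
  have key : ∀ e g, Φ.extendV q (Φ.onV (G.tail e, g)) =
      Φ.extendV q (Φ.onV (G.head e, g + G.color e)) ↔ G.displacement e q = 0 := by
    intro e g
    rw [extendV_onV, extendV_onV, coneRotation_add, (coneRotation k g).injective.eq_iff,
      displacement_apply, sub_eq_zero, eq_comm]
  constructor
  · intro h e he
    exact h _ _ _ (Φ.ends_onE_eq e 0) ((key e 0).2 he)
  · intro h e i j hij heq
    obtain ⟨⟨e, g⟩, rfl⟩ := Φ.onE.surjective e
    rw [Φ.ends_onE_eq, Sym2.eq_iff] at hij
    rcases hij with ⟨rfl, rfl⟩ | ⟨rfl, rfl⟩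
    · exact h e ((key e g).1 heq)
    · exact h e ((key e g).1 heq.symm)

theorem extendV_smul (Φ : SymmetricGraph.Iso G.lift S) (c : ℝ) (q : V → ℂ) :
    Φ.extendV (c • q) = c • Φ.extendV q := by
  ext1 v
  simp only [extendV, Pi.smul_apply, map_smul]

theorem exists_eq_extendV (Φ : SymmetricGraph.Iso G.lift S) {p : V' → ℂ}
    (hp : ∀ g i, p (S.actV g i) = coneRotation k g (p i)) : ∃ q, p = Φ.extendV q := by
  refine ⟨fun i => p (Φ.onV (i, 0)), ?_⟩
  ext1 v
  obtain ⟨⟨i, g⟩, rfl⟩ := Φ.onV.surjective v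
  rw [extendV_onV, Φ.onV_eq, hp]

theorem extendV_injective (Φ : SymmetricGraph.Iso G.lift S) :
    Function.Injective Φ.extendV := by
  intro q r h
  ext1 i
  have := congrFun h (Φ.onV (i, 0))
  rwa [extendV_onV, extendV_onV, coneRotation_zero, coneRotation_zero] at this

theorem hasUniqueFaithfulRealization_iff (Φ : SymmetricGraph.Iso G.lift S) {d : E' → ℂ}
    (hd : d ∈ S.Directions) :
    S.HasUniqueFaithfulRealization d ↔
      G.HasUniqueFaithfulPlacement fun e => d (Φ.onE (e, 0)) := by
  constructor
  · rintro ⟨p, hp, hfaith, huniq⟩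
    obtain ⟨q, rfl⟩ := Φ.exists_eq_extendV hp.2
    refine ⟨q, (Φ.isRealization_extendV_iff hd q).1 hp, (Φ.isFaithful_extendV_iff q).1 hfaith,
      fun r hr hr' => ?_⟩
    obtain ⟨c, hc⟩ := huniq _ ((Φ.isRealization_extendV_iff hd r).2 hr)
      ((Φ.isFaithful_extendV_iff r).2 hr')
    exact ⟨c, Φ.extendV_injective (by rw [hc, extendV_smul])⟩
  · rintro ⟨q, hq, hfaith, huniq⟩
    refine ⟨Φ.extendV q, (Φ.isRealization_extendV_iff hd q).2 hq,
      (Φ.isFaithful_extendV_iff q).2 hfaith, fun p hp hp' => ?_⟩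
    obtain ⟨r, rfl⟩ := Φ.exists_eq_extendV hp.2
    obtain ⟨c, rfl⟩ := huniq r ((Φ.isRealization_extendV_iff hd r).1 hp)
      ((Φ.isFaithful_extendV_iff r).1 hp')
    exact ⟨c, Φ.extendV_smul c q⟩

/-- A generic property of the directions of the edge representatives is a generic property of the
symmetric direction assignments. -/
theorem generically_of_holdsGenerically (Φ : SymmetricGraph.Iso G.lift S) {P : (E → ℂ) → Prop}
    (hP : HoldsGenerically fun x => P (dirs x)) :
    S.Generically fun d => P fun e => d (Φ.onE (e, 0)) := by
  obtain ⟨f, hf, hfP⟩ := hP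
  let ι : E × Fin 2 → E' × Fin 2 := fun x => (Φ.onE (x.1, 0), x.2)
  have hcoords : ∀ d : E' → ℂ, coords d ∘ ι = coords fun e => d (Φ.onE (e, 0)) := fun d => rfl
  have hmem : ∀ d, d ∈ S.algebraicSubset {MvPolynomial.rename ι f} ↔ d ∈ S.Directions ∧
      MvPolynomial.eval (coords fun e => d (Φ.onE (e, 0))) f = 0 := by
    intro d
    simp [algebraicSubset, MvPolynomial.eval_rename, hcoords]
  refine ⟨{MvPolynomial.rename ι f}, fun heq => hf ?_, fun d hd hd' => ?_⟩
  -- The algebraic subset is proper because every `x` extends to a symmetric assignment; were the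
  -- subset everything, `f` would vanish at all real points.
  · refine MvPolynomial.funext fun x => ?_
    have h := ((hmem _).1 (heq.symm ▸ Φ.extendE_mem_directions (dirs x))).2
    simp only [extendE_onE, coneRotation_zero] at h
    have hx : coords (fun e => dirs x e) = x := by
      ext ⟨e, i⟩
      fin_cases i <;> simp [coords, dirs]
    rw [hx] at h
    rw [h, map_zero]
  · have h : MvPolynomial.eval (coords fun e => d (Φ.onE (e, 0))) f ≠ 0 :=
      fun h => hd' ((hmem d).2 ⟨hd, h⟩)
    simpa only [dirs_coords] using hfP _ h

end SymmetricGraph.Iso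

theorem theorem3 {k : ℕ} [NeZero k] (hk : 2 ≤ k)
    {V' E' : Type*} [Finite V'] [Finite E'] [Nonempty V'] (S : SymmetricGraph k V' E')
    {V E : Type*} [Fintype V] [Fintype E] (G : ColoredGraph k V E)
    (hG : G.IsAssociatedWith S) :
    S.Generically fun d => S.HasUniqueFaithfulRealization d ↔ G.IsConeLaman := by
  obtain ⟨Φ⟩ := hG
  have : Nonempty V := ⟨(Φ.onV.symm (Classical.arbitrary V')).1⟩
  obtain ⟨I, hI, hIP⟩ := Φ.generically_of_holdsGenerically
    (P := fun d => G.HasUniqueFaithfulPlacement d ↔ G.IsConeLaman)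
    G.generically_hasUniqueFaithfulPlacement_iff
  exact ⟨I, hI, fun d hd hd' => (Φ.hasUniqueFaithfulRealization_iff hd).trans (hIP d hd hd')⟩
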